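/- Let $S$ be a (non-empty, Hausdorff) semitopological semigroup, i.e. a semigroup with a Hausdorff topology such that all maps $\lambda_s:t\mapsto st$ and $\rho_s:t\mapsto ts$ are continuous, and let $C(S)$ be the $C^*$-algebra of bounded continuous functions $S\to\mathbb{C}$. For $s\in S$ put $L_sf=f\circ\lambda_s$ and $R_sf=f\circ\rho_s$. Let $\mathcal{F}$ be an m-admissible subalgebra of $C(S)$: a norm closed, conjugation invariant subalgebra containing the constants, such that $L_sf,R_sf\in\mathcal{F}$ for all $f\in\mathcal{F}$, $s\in S$, and such that for every $\mu$ in the spectrum $\Delta$ of $\mathcal{F}$ (the set of non-zero multiplicative continuous linear functionals on $\mathcal{F}$) and every $f\in\mathcal{F}$ the function $T_\mu f:s\mapsto\mu(L_sf)$ belongs to $\mathcal{F}$. Then $\Delta$ is a semigroup under $(\mu\nu)(f)=\mu(T_\nu f)$. An $\mathcal{F}$-filter on $S$ is a (proper) filter $\varphi$ on $S$ such that for every $A\in\varphi$ with $A\ne S$ there are $B\in\varphi$ and $f\in\mathcal{F}$ with $f=0$ on $B$ and $f=1$ on $S\setminus A$; an $\mathcal{F}$-ultrafilter is an $\mathcal{F}$-filter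 that is maximal with respect to inclusion. Let $\delta S$ be the set of all $\mathcal{F}$-ultrafilters on $S$. The map sending $\mu\in\Delta$ to the filter generated by the sets $\{s\in S:|f(s)|\le r\}$, $f\in\ker\mu$, $r>0$, is a bijection from $\Delta$ onto $\delta S$, and $\delta S$ is given the semigroup operation transported from $\Delta$ by this bijection. For $A\subseteq S$ and $s\in S$ let $s^{-1}A=\{t\in S:st\in A\}$; call $A$ syndetic if $S=\bigcup_{s\in E}s^{-1}A$ for some finite $E\subseteq S$. For $p\in\delta S$ put $\Omega_p(A)=\{s\in S:s^{-1}A\in p\}$. Theorem. The semigroup $\delta S$ has a smallest (two-sided, non-empty) ideal $K$, namely the intersection of all its ideals, and for every $p\in\delta S$ the following statements are equivalent: (i) $p\in K$; (ii) for every $A\in p$ the set $\Omega_p(A)$ is syndetic; (iii) for every $q\in\delta S$ we have $p\in(\delta S)qp$, i.e. $p=xqp$ for some $x\in\delta S$. -/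

import Mathlib

open Filter BoundedContinuousFunction

section Semigroups

/-- A (two-sided) ideal of a semigroup: a non-empty set absorbing multiplication on both sides. -/
def IsSemigroupIdeal {T : Type*} [Semigroup T] (I : Set T) : Prop :=
  I.Nonempty ∧ ∀ x : T, ∀ y ∈ I, x * y ∈ I ∧ y * x ∈ I

/-- The intersection of all ideals of `T`; it is the smallest ideal as soon as it is non-empty. -/
def smallestIdeal (T : Type*) [Semigroup T] : Set T :=
  ⋂₀ {I : Set T | IsSemigroupIdeal I}

/-- `A ⊆ S` is syndetic if `S` is a finite union of sets `s⁻¹A = {t | s * t ∈ A}`. -/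
def IsSyndetic {S : Type*} [Semigroup S] (A : Set S) : Prop :=
  ∃ E : Finset S, ⋃ s ∈ E, (fun t => s * t) ⁻¹' A = Set.univ

end Semigroups

section Translations

variable {S : Type*} [Semigroup S] [TopologicalSpace S] [SeparatelyContinuousMul S]

/-- `L_s f = f ∘ λ_s`, that is, `(L_s f)(t) = f (s t)`. -/
noncomputable def leftTranslate (s : S) (f : S →ᵇ ℂ) : S →ᵇ ℂ :=
  f.compContinuous ⟨fun t => s * t, SeparatelyContinuousMul.continuous_const_mul⟩

/-- `R_s f = f ∘ ρ_s`, that is, `(R_s f)(t) = f (t s)`. -/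
noncomputable def rightTranslate (s : S) (f : S →ᵇ ℂ) : S →ᵇ ℂ :=
  f.compContinuous ⟨fun t => t * s, SeparatelyContinuousMul.continuous_mul_const⟩

@[simp] lemma leftTranslate_apply (s t : S) (f : S →ᵇ ℂ) : leftTranslate s f t = f (s * t) := rfl

@[simp] lemma rightTranslate_apply (s t : S) (f : S →ᵇ ℂ) : rightTranslate s f t = f (t * s) := rfl

end Translations

/-- An m-admissible subalgebra of the algebra of bounded continuous complex functions on a
semitopological semigroup `S`: a norm closed, unital, conjugation invariant subalgebra which is
left and right translation invariant and such that, for every character `μ` of the subalgebra,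
the function `T_μ f : s ↦ μ (L_s f)` belongs to the subalgebra whenever `f` does. -/
structure MAdmissibleSubalgebra (S : Type*) [Semigroup S] [TopologicalSpace S]
    [SeparatelyContinuousMul S] where
  alg : StarSubalgebra ℂ (S →ᵇ ℂ)
  isClosed_alg : IsClosed (alg : Set (S →ᵇ ℂ))
  left_mem : ∀ (s : S) (f : S →ᵇ ℂ), f ∈ alg → leftTranslate s f ∈ alg
  right_mem : ∀ (s : S) (f : S →ᵇ ℂ), f ∈ alg → rightTranslate s f ∈ alg
  introverted : ∀ (μ : WeakDual.characterSpace ℂ alg) (f : alg),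
    ∃ g ∈ alg, ∀ s : S, g s = μ ⟨leftTranslate s f, left_mem s f f.2⟩

section FFilters

variable {S : Type*} [TopologicalSpace S]

/-- An `𝓐`-filter: a proper filter `φ` such that for every `A ∈ φ` with `A ≠ S` there are `B ∈ φ`
and `f ∈ 𝓐` with `f = 0` on `B` and `f = 1` on `S \ A`. -/
def IsFFilter (𝓐 : StarSubalgebra ℂ (S →ᵇ ℂ)) (φ : Filter S) : Prop :=
  φ.NeBot ∧ ∀ A ∈ φ, A ≠ Set.univ →
    ∃ B ∈ φ, ∃ f ∈ 𝓐, (∀ x ∈ B, f x = 0) ∧ ∀ x ∉ A, f x = 1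

/-- An `𝓐`-ultrafilter: an `𝓐`-filter which is maximal under inclusion of families of sets
(in Mathlib's order of filters `ψ ≤ φ` means that every member of `φ` is a member of `ψ`). -/
def IsFUltrafilter (𝓐 : StarSubalgebra ℂ (S →ᵇ ℂ)) (φ : Filter S) : Prop :=
  IsFFilter 𝓐 φ ∧ ∀ ψ : Filter S, IsFFilter 𝓐 ψ → ψ ≤ φ → ψ = φ

/-- The filter generated by the sets `S(f, r) = {s | |f s| ≤ r}` with `f ∈ ker μ` and `r > 0`. -/
def kerFilter (𝓐 : StarSubalgebra ℂ (S →ᵇ ℂ)) (μ : WeakDual.characterSpace ℂ 𝓐) : Filter S :=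
  Filter.generate {A | ∃ f : 𝓐, μ f = 0 ∧ ∃ r : ℝ, 0 < r ∧ A = {s | ‖(f : S →ᵇ ℂ) s‖ ≤ r}}

variable {𝓐 : StarSubalgebra ℂ (S →ᵇ ℂ)}

lemma sublevel_nonempty [Nonempty S] (μ : WeakDual.characterSpace ℂ 𝓐) (f : 𝓐) (hf : μ f = 0)
    (h𝓐 : IsClosed (𝓐 : Set (S →ᵇ ℂ))) {r : ℝ} (hr : 0 < r) :
    ∃ s, ‖(f : S →ᵇ ℂ) s‖ ≤ r := by
  have := h𝓐
  by_contra! hcon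
  have hu : ¬ IsUnit f := fun hu => by
    have := hu.map (WeakDual.CharacterSpace.equivAlgHom μ)
    rw [WeakDual.CharacterSpace.equivAlgHom_coe, hf] at this
    exact not_isUnit_zero this
  apply hu
  rw [← StarSubalgebra.coe_isUnit]
  have hne : ∀ s, (f : S →ᵇ ℂ) s ≠ 0 := fun s h => by
    have := hcon s; rw [h, norm_zero] at this; linarith
  let g : S →ᵇ ℂ := BoundedContinuousFunction.ofNormedAddCommGroup
    (fun s => ((f : S →ᵇ ℂ) s)⁻¹) ((f : S →ᵇ ℂ).continuous.inv₀ hne) r⁻¹ (fun s => by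
      rw [norm_inv]; exact inv_anti₀ hr (hcon s).le)
  refine IsUnit.of_mul_eq_one g ?_
  ext s
  exact mul_inv_cancel₀ (hne s)

lemma mem_kerFilter_iff (μ : WeakDual.characterSpace ℂ 𝓐) (A : Set S) :
    A ∈ kerFilter 𝓐 μ ↔
      ∃ f : 𝓐, μ f = 0 ∧ ∃ r : ℝ, 0 < r ∧ {s | ‖(f : S →ᵇ ℂ) s‖ ≤ r} ⊆ A := by
  constructor
  · intro h
    induction h with
    | basic h =>
      obtain ⟨f, hf, r, hr, rfl⟩ := h
      exact ⟨f, hf, r, hr, subset_rfl⟩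
    | univ => exact ⟨0, map_zero _, 1, one_pos, Set.subset_univ _⟩
    | superset _ hst ih =>
      obtain ⟨f, hf, r, hr, h⟩ := ih
      exact ⟨f, hf, r, hr, h.trans hst⟩
    | inter _ _ ih₁ ih₂ =>
      obtain ⟨f, hf, r, hr, h⟩ := ih₁
      obtain ⟨g, hg, q, hq, h'⟩ := ih₂
      have key : ∀ s, (((star f * f + star g * g : 𝓐) : S →ᵇ ℂ) s) =
          ((‖(f : S →ᵇ ℂ) s‖ ^ 2 + ‖(g : S →ᵇ ℂ) s‖ ^ 2 : ℝ) : ℂ) := fun s => by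
        have h1 : ∀ z : ℂ, (starRingEnd ℂ) z * z = ((‖z‖ ^ 2 : ℝ) : ℂ) := fun z => by
          rw [mul_comm, Complex.mul_conj, Complex.normSq_eq_norm_sq]
        push_cast
        have := h1 ((f : S →ᵇ ℂ) s)
        have h2 := h1 ((g : S →ᵇ ℂ) s)
        push_cast at this h2
        rw [← this, ← h2]
        rfl
      refine ⟨star f * f + star g * g, by simp [hf, hg], (min r q) ^ 2, by positivity, ?_⟩
      intro s hs
      have hs' : ‖(f : S →ᵇ ℂ) s‖ ^ 2 + ‖(g : S →ᵇ ℂ) s‖ ^ 2 ≤ (min r q) ^ 2 := by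
        have hs2 : ‖(((star f * f + star g * g : 𝓐) : S →ᵇ ℂ) s)‖ ≤ (min r q) ^ 2 := hs
        rw [key, Complex.norm_real, Real.norm_of_nonneg (by positivity)] at hs2
        exact hs2
      have hm : 0 < min r q := lt_min hr hq
      constructor
      · apply h
        exact (abs_le_of_sq_le_sq' (by nlinarith [sq_nonneg ‖(g : S →ᵇ ℂ) s‖]) hm.le).2.trans
          (min_le_left _ _)
      · apply h'
        exact (abs_le_of_sq_le_sq' (by nlinarith [sq_nonneg ‖(f : S →ᵇ ℂ) s‖]) hm.le).2.trans
          (min_le_right _ _)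
  · rintro ⟨f, hf, r, hr, h⟩
    exact Filter.mem_of_superset (Filter.mem_generate_of_mem ⟨f, hf, r, hr, rfl⟩) h

/-- Evaluation at a point, as a star homomorphism on `𝓐`. -/
noncomputable def evalStarHom (𝓐 : StarSubalgebra ℂ (S →ᵇ ℂ)) (s : S) : 𝓐 →⋆ₐ[ℂ] ℂ where
  toFun f := (f : S →ᵇ ℂ) s
  map_one' := rfl
  map_mul' _ _ := rfl
  map_zero' := rfl
  map_add' _ _ := rfl
  commutes' _ := rfl
  map_star' _ := rfl

lemma exists_separating (h𝓐 : IsClosed (𝓐 : Set (S →ᵇ ℂ))) (f : 𝓐) {r : ℝ} (hr : 0 < r) :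
    ∃ g : 𝓐, (∀ s, ‖(f : S →ᵇ ℂ) s‖ ≤ r / 2 → (g : S →ᵇ ℂ) s = 0) ∧
      ∀ s, r < ‖(f : S →ᵇ ℂ) s‖ → (g : S →ᵇ ℂ) s = 1 := by
  have := h𝓐
  let F : ℂ → ℂ := fun z => ((max 0 (min 1 (2 * ‖z‖ / r - 1)) : ℝ) : ℂ)
  have hF : Continuous F := by fun_prop
  have hev : ∀ s, ((cfc F f : 𝓐) : S →ᵇ ℂ) s = F ((f : S →ᵇ ℂ) s) := by
    intro s
    have hc : Continuous (evalStarHom 𝓐 s) :=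
      (BoundedContinuousFunction.lipschitz_eval_const s).continuous.comp continuous_subtype_val
    have h1 := StarAlgHom.map_cfc (evalStarHom 𝓐 s) F f hF.continuousOn hc
      (IsStarNormal.mk (mul_comm _ _)) (IsStarNormal.mk (mul_comm _ _))
    have h2 := cfc_algebraMap (A := ℂ) ((f : S →ᵇ ℂ) s) F
    exact h1.trans h2
  refine ⟨cfc F f, fun s hs => ?_, fun s hs => ?_⟩
  · rw [hev]
    have : 2 * ‖(f : S →ᵇ ℂ) s‖ / r - 1 ≤ 0 := by
      rw [sub_nonpos, div_le_one hr]; linarith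
    simp only [F]
    rw [max_eq_left ((min_le_right _ _).trans this)]
    simp
  · rw [hev]
    have : 1 ≤ 2 * ‖(f : S →ᵇ ℂ) s‖ / r - 1 := by
      rw [le_sub_iff_add_le, le_div_iff₀ hr]; linarith
    simp only [F]
    rw [min_eq_left this]
    simp

lemma isFFilter_kerFilter [Nonempty S] (h𝓐 : IsClosed (𝓐 : Set (S →ᵇ ℂ)))
    (μ : WeakDual.characterSpace ℂ 𝓐) : IsFFilter 𝓐 (kerFilter 𝓐 μ) := by
  refine ⟨?_, ?_⟩
  · rw [← Filter.forall_mem_nonempty_iff_neBot]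
    intro A hA
    obtain ⟨f, hf, r, hr, h⟩ := (mem_kerFilter_iff μ A).1 hA
    obtain ⟨s, hs⟩ := sublevel_nonempty μ f hf h𝓐 hr
    exact ⟨s, h hs⟩
  · intro A hA _
    obtain ⟨f, hf, r, hr, h⟩ := (mem_kerFilter_iff μ A).1 hA
    obtain ⟨g, hg0, hg1⟩ := exists_separating h𝓐 f hr
    refine ⟨{s | ‖(f : S →ᵇ ℂ) s‖ ≤ r / 2},
      (mem_kerFilter_iff μ _).2 ⟨f, hf, r / 2, by positivity, subset_rfl⟩, g, g.2, hg0, ?_⟩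
    intro s hs
    exact hg1 s (not_le.1 fun hle => hs (h hle))

lemma sub_const_mem_ker (μ : WeakDual.characterSpace ℂ 𝓐) (f : 𝓐) :
    μ (f - algebraMap ℂ 𝓐 (μ f)) = 0 := by
  rw [map_sub, AlgHomClass.commutes]
  exact sub_self _

lemma apply_eq_zero_of_frequently {μ : WeakDual.characterSpace ℂ 𝓐} {φ : Filter S} [φ.NeBot]
    (hφ : φ ≤ kerFilter 𝓐 μ) (f : 𝓐)
    (h : ∀ r : ℝ, 0 < r → {s | ‖(f : S →ᵇ ℂ) s‖ ≤ r} ∈ φ) : μ f = 0 := by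
  by_contra hne
  have hpos : 0 < ‖μ f‖ := norm_pos_iff.2 hne
  have h1 : {s | ‖((f - algebraMap ℂ 𝓐 (μ f) : 𝓐) : S →ᵇ ℂ) s‖ ≤ ‖μ f‖ / 3} ∈ φ :=
    hφ ((mem_kerFilter_iff μ _).2 ⟨_, sub_const_mem_ker μ f, _, by positivity, subset_rfl⟩)
  obtain ⟨s, hs1, hs2⟩ := Filter.nonempty_of_mem
    (Filter.inter_mem h1 (h (‖μ f‖ / 3) (by positivity)))
  have hs1' : ‖(f : S →ᵇ ℂ) s - μ f‖ ≤ ‖μ f‖ / 3 := hs1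
  have hs2' : ‖(f : S →ᵇ ℂ) s‖ ≤ ‖μ f‖ / 3 := hs2
  have := norm_sub_norm_le (μ f) ((f : S →ᵇ ℂ) s)
  rw [norm_sub_rev] at this
  linarith

lemma isFUltrafilter_kerFilter [Nonempty S] (h𝓐 : IsClosed (𝓐 : Set (S →ᵇ ℂ)))
    (μ : WeakDual.characterSpace ℂ 𝓐) : IsFUltrafilter 𝓐 (kerFilter 𝓐 μ) := by
  refine ⟨isFFilter_kerFilter h𝓐 μ, fun ψ hψ hle => le_antisymm hle fun A hA => ?_⟩
  have := hψ.1
  by_cases hAu : A = Set.univ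
  · rw [hAu]; exact Filter.univ_mem
  obtain ⟨B, hB, f, hf, hf0, hf1⟩ := hψ.2 A hA hAu
  refine (mem_kerFilter_iff μ A).2 ⟨⟨f, hf⟩, ?_, 1 / 2, by norm_num, ?_⟩
  · refine apply_eq_zero_of_frequently hle _ fun r hr => Filter.mem_of_superset hB fun s hs => ?_
    change ‖f s‖ ≤ r
    rw [hf0 s hs, norm_zero]
    exact hr.le
  · intro s hs
    by_contra hsA
    have hs' : ‖f s‖ ≤ 1 / 2 := hs
    rw [hf1 s hsA, norm_one] at hs'
    norm_num at hs'

lemma kerFilter_injective [Nonempty S] (h𝓐 : IsClosed (𝓐 : Set (S →ᵇ ℂ))) :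
    Function.Injective (kerFilter 𝓐) := by
  intro μ ν h
  have := (isFFilter_kerFilter h𝓐 μ).1
  have key : ∀ f : 𝓐, μ f = 0 → ν f = 0 := fun f hf =>
    apply_eq_zero_of_frequently (φ := kerFilter 𝓐 μ) h.le f
      fun r hr => (mem_kerFilter_iff μ _).2 ⟨f, hf, r, hr, subset_rfl⟩
  ext f
  have := key _ (sub_const_mem_ker μ f)
  rw [map_sub, AlgHomClass.commutes] at this
  exact (sub_eq_zero.1 this).symm

lemma kerFilter_surjective [Nonempty S] (h𝓐 : IsClosed (𝓐 : Set (S →ᵇ ℂ))) {φ : Filter S}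
    (hφ : IsFUltrafilter 𝓐 φ) : ∃ μ, kerFilter 𝓐 μ = φ := by
  have := h𝓐
  have := hφ.1.1
  let I : Ideal 𝓐 :=
    { carrier := {f | ∀ᶠ s in φ, (f : S →ᵇ ℂ) s = 0}
      add_mem' := by
        intro f g hf hg
        filter_upwards [hf, hg] with s hs1 hs2
        change (f : S →ᵇ ℂ) s + (g : S →ᵇ ℂ) s = 0
        rw [hs1, hs2, add_zero]
      zero_mem' := Filter.Eventually.of_forall fun _ => rfl
      smul_mem' := by
        intro c f hf
        filter_upwards [hf] with s hs
        change (c : S →ᵇ ℂ) s * (f : S →ᵇ ℂ) s = 0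
        rw [hs, mul_zero] }
  have hI : I ≠ ⊤ := by
    rw [Ideal.ne_top_iff_one]
    intro h
    obtain ⟨s, hs⟩ := Filter.Eventually.exists (f := φ) h
    exact one_ne_zero (α := ℂ) hs
  obtain ⟨M, hM, hIM⟩ := Ideal.exists_le_maximal I hI
  refine ⟨M.toCharacterSpace, hφ.2 _ (isFFilter_kerFilter h𝓐 _) fun A hA => ?_⟩
  by_cases hAu : A = Set.univ
  · rw [hAu]; exact Filter.univ_mem
  obtain ⟨B, hB, f, hf, hf0, hf1⟩ := hφ.1.2 A hA hAu
  refine (mem_kerFilter_iff _ A).2 ⟨⟨f, hf⟩,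
    M.toCharacterSpace_apply_eq_zero_of_mem (hIM (Filter.mem_of_superset hB hf0)),
    1 / 2, by norm_num, ?_⟩
  intro s hs
  by_contra hsA
  have hs' : ‖f s‖ ≤ 1 / 2 := hs
  rw [hf1 s hsA, norm_one] at hs'
  norm_num at hs'

end FFilters

namespace MAdmissibleSubalgebra

variable {S : Type*} [Semigroup S] [TopologicalSpace S] [SeparatelyContinuousMul S]
  (F : MAdmissibleSubalgebra S)

/-- The spectrum `Δ` of `F`: the non-zero multiplicative continuous functionals on `F`. -/
abbrev Spectrum : Type _ := WeakDual.characterSpace ℂ F.alg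

/-- `L_s` as a map of `F` into itself. -/
noncomputable def L (s : S) (f : F.alg) : F.alg := ⟨leftTranslate s f, F.left_mem s f f.2⟩

lemma T_mem (μ : F.Spectrum) (f : F.alg) :
    ∃ g : F.alg, ∀ s : S, (g : S →ᵇ ℂ) s = μ (F.L s f) := by
  obtain ⟨g, hg, h⟩ := F.introverted μ f
  exact ⟨⟨g, hg⟩, h⟩

/-- The left introversion operator `(T_μ f)(s) = μ (L_s f)`, as an algebra endomorphism of `F`. -/
noncomputable def T (μ : F.Spectrum) : F.alg →ₐ[ℂ] F.alg where
  toFun f := (F.T_mem μ f).choose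
  map_one' := by
    ext s
    rw [(F.T_mem μ 1).choose_spec s]
    exact map_one μ
  map_mul' f g := by
    ext s
    rw [(F.T_mem μ (f * g)).choose_spec s]
    change _ = ((F.T_mem μ f).choose : S →ᵇ ℂ) s * ((F.T_mem μ g).choose : S →ᵇ ℂ) s
    rw [(F.T_mem μ f).choose_spec s, (F.T_mem μ g).choose_spec s]
    exact map_mul μ (F.L s f) (F.L s g)
  map_zero' := by
    ext s
    rw [(F.T_mem μ 0).choose_spec s]
    exact map_zero μ
  map_add' f g := by
    ext s
    rw [(F.T_mem μ (f + g)).choose_spec s]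
    change _ = ((F.T_mem μ f).choose : S →ᵇ ℂ) s + ((F.T_mem μ g).choose : S →ᵇ ℂ) s
    rw [(F.T_mem μ f).choose_spec s, (F.T_mem μ g).choose_spec s]
    exact map_add μ (F.L s f) (F.L s g)
  commutes' c := by
    ext s
    rw [(F.T_mem μ (algebraMap ℂ F.alg c)).choose_spec s]
    exact AlgHomClass.commutes μ c

lemma T_apply (μ : F.Spectrum) (f : F.alg) (s : S) :
    ((F.T μ f : F.alg) : S →ᵇ ℂ) s = μ (F.L s f) :=
  (F.T_mem μ f).choose_spec s

/-- The product of the spectrum: `(μν)(f) = μ (T_ν f)`. -/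
noncomputable def spectrumMul (μ ν : F.Spectrum) : F.Spectrum :=
  haveI : IsClosed (F.alg : Set (S →ᵇ ℂ)) := F.isClosed_alg
  WeakDual.CharacterSpace.equivAlgHom.symm
    ((WeakDual.CharacterSpace.equivAlgHom μ).comp (F.T ν))

lemma spectrumMul_apply (μ ν : F.Spectrum) (f : F.alg) :
    F.spectrumMul μ ν f = μ (F.T ν f) := rfl

lemma spectrumMul_assoc (μ ν κ : F.Spectrum) :
    F.spectrumMul (F.spectrumMul μ ν) κ = F.spectrumMul μ (F.spectrumMul ν κ) := by
  ext f
  rw [spectrumMul_apply, spectrumMul_apply, spectrumMul_apply]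
  congr 1
  ext s
  rw [T_apply, T_apply, spectrumMul_apply]
  congr 1
  ext t
  rw [T_apply]
  change ((F.T κ f : F.alg) : S →ᵇ ℂ) (s * t) = _
  rw [T_apply]
  congr 1
  ext u
  change (f : S →ᵇ ℂ) (s * t * u) = (f : S →ᵇ ℂ) (s * (t * u))
  rw [mul_assoc]

/-- `δS`, the set of all `F`-ultrafilters on `S`. -/
def DeltaS : Type _ := {p : Filter S // IsFUltrafilter F.alg p}

variable {F} in
/-- `p.filter` is the point `p` of `δS` as a filter on `S`. -/
def DeltaS.filter (p : F.DeltaS) : Filter S := p.1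

/-- The canonical bijection `Δ ≃ δS` sending `μ` to the filter generated by the sets
`{s | |f s| ≤ r}` with `f ∈ ker μ` and `r > 0`. -/
noncomputable def spectrumEquiv [Nonempty S] : F.Spectrum ≃ F.DeltaS :=
  Equiv.ofBijective
    (fun μ => ⟨kerFilter F.alg μ, isFUltrafilter_kerFilter F.isClosed_alg μ⟩)
    ⟨fun _ _ h => kerFilter_injective F.isClosed_alg (congrArg Subtype.val h),
      fun p => (kerFilter_surjective F.isClosed_alg p.2).imp fun _ h => Subtype.ext h⟩

/-- The semigroup operation of `δS`, transported from the spectrum. -/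
noncomputable instance [Nonempty S] : Semigroup F.DeltaS where
  mul p q := F.spectrumEquiv (F.spectrumMul (F.spectrumEquiv.symm p) (F.spectrumEquiv.symm q))
  mul_assoc p q r := by
    change F.spectrumEquiv (F.spectrumMul (F.spectrumEquiv.symm (F.spectrumEquiv _)) _) =
      F.spectrumEquiv (F.spectrumMul _ (F.spectrumEquiv.symm (F.spectrumEquiv _)))
    rw [Equiv.symm_apply_apply, Equiv.symm_apply_apply, spectrumMul_assoc]

/-- `Ω_p(A) = {s | s⁻¹A ∈ p}`, where `s⁻¹A = {t | s * t ∈ A}`. -/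
def Omega (p : F.DeltaS) (A : Set S) : Set S := {s | (fun t => s * t) ⁻¹' A ∈ p.filter}

end MAdmissibleSubalgebra

/-! The spectrum with its weak* topology is a compact Hausdorff semigroup in which right
multiplications are continuous. Point evaluations map `S` homomorphically onto a dense subset, and
left multiplication by an evaluation is continuous too. Moreover `kerFilter 𝓐 μ` is the trace on `S`
of the neighbourhoods of `μ` (`kerFilter_eq_comap`), so the theorem concerns only a compact right
topological semigroup `T` and a dense homomorphism `ε : S → T`.

In such a `T`, Zorn's lemma gives a minimal closed left ideal, and each of its points satisfies
(iii). The points satisfying (iii) form an ideal contained in every other, hence equal to `K`.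
Between (ii) and (iii), finiteness of `E` matches compactness of `T`: a finite cover of `S` by
closed conditions extends to `T` by density, and conversely (iii) yields an open cover of `T`
indexed by `S`, with a finite subcover. -/

open Topology Set

/-! ### Compact right topological semigroups with a dense homomorphic image of `S` -/

section CompactRightTopological

variable {T : Type*} [Semigroup T]

/-- The points `p` lying in `T q p` for every `q` form an ideal as soon as there is one. -/
lemma isSemigroupIdeal_setOf_forall_exists_eq_mul
    (h : ∃ p : T, ∀ q : T, ∃ x : T, p = x * q * p) :
    IsSemigroupIdeal {p : T | ∀ q : T, ∃ x : T, p = x * q * p} := by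
  refine ⟨h, fun y p hp => ⟨fun q => ?_, fun q => ?_⟩⟩
  -- From `p = x(qy)p` follows `yp = (yx)q(yp)`.
  · obtain ⟨x, hx⟩ := hp (q * y)
    refine ⟨y * x, ?_⟩
    conv_lhs => rw [hx]
    simp only [mul_assoc]
  · obtain ⟨x, hx⟩ := hp q
    refine ⟨x, ?_⟩
    conv_lhs => rw [hx]
    simp only [mul_assoc]

lemma smallestIdeal_eq_setOf_forall_exists_eq_mul
    (h : ∃ p : T, ∀ q : T, ∃ x : T, p = x * q * p) :
    smallestIdeal T = {p : T | ∀ q : T, ∃ x : T, p = x * q * p} := by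
  refine Subset.antisymm (sInter_subset_of_mem (isSemigroupIdeal_setOf_forall_exists_eq_mul h))
    fun p hp J hJ => ?_
  obtain ⟨j, hj⟩ := hJ.1
  obtain ⟨x, hx⟩ := hp j
  -- Since `j` lies in the ideal `J`, so does `p = xjp`.
  rw [hx]
  exact (hJ.2 p _ (hJ.2 x j hj).1).2

variable [TopologicalSpace T] [CompactSpace T]

/-- A compact right topological semigroup has a point lying in a minimal left ideal. -/
lemma exists_forall_exists_eq_mul [T2Space T] [Nonempty T]
    (hmul : ∀ q : T, Continuous fun x : T => x * q) :
    ∃ p : T, ∀ q : T, ∃ x : T, p = x * q * p := by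
  let 𝓛 : Set (Set T) := {L | IsClosed L ∧ L.Nonempty ∧ ∀ x : T, ∀ y ∈ L, x * y ∈ L}
  obtain ⟨L, hL⟩ : ∃ L, Minimal (· ∈ 𝓛) L := by
    refine zorn_superset 𝓛 fun c hc hchain => ?_
    rcases c.eq_empty_or_nonempty with rfl | hne
    · exact ⟨univ, ⟨isClosed_univ, univ_nonempty, fun _ _ _ => mem_univ _⟩, by simp⟩
    refine ⟨⋂₀ c, ⟨isClosed_sInter fun L hL => (hc hL).1, ?_, ?_⟩,
      fun L hL => sInter_subset_of_mem hL⟩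
    · have := hne.to_subtype
      exact IsCompact.nonempty_sInter_of_directed_nonempty_isCompact_isClosed
        (fun A hA B hB => (hchain.total hA hB).elim (fun h => ⟨A, hA, subset_rfl, h⟩)
          fun h => ⟨B, hB, h, subset_rfl⟩) (fun L hL => (hc hL).2.1) (fun L hL => (hc hL).1.isCompact)
        (fun L hL => (hc hL).1)
    · exact fun x y hy L hL => (hc hL).2.2 x y (hy L hL)
  obtain ⟨p, hp⟩ := hL.prop.2.1
  refine ⟨p, fun q => ?_⟩
  have hqp : q * p ∈ L := hL.prop.2.2 q p hp
  -- `Tqp` is a left ideal inside `L`, closed as a compact image, so minimality forces `p ∈ Tqp`.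
  have hmem : range (fun x : T => x * (q * p)) ∈ 𝓛 := by
    refine ⟨(isCompact_range (hmul _)).isClosed, range_nonempty _, ?_⟩
    rintro x _ ⟨y, rfl⟩
    exact ⟨x * y, mul_assoc x y _⟩
  have hsub : range (fun x : T => x * (q * p)) ≤ L := by
    rintro _ ⟨x, rfl⟩
    exact hL.prop.2.2 x _ hqp
  obtain ⟨x, hx⟩ := hL.le_of_le hmem hsub hp
  exact ⟨x, by rw [mul_assoc]; exact hx.symm⟩

variable {S : Type*} [Semigroup S] {ε : S →ₙ* T}

/-- For each `A` in the trace of `p`, syndeticity provides some `s` with `ε(s)qp` in the closure of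
`ε(A)`. Compactness gives one `x` serving all `A`, and Hausdorffness then identifies `xqp` with `p`.
-/
lemma exists_eq_mul_of_isSyndetic [T2Space T] (hε : DenseRange ε)
    (hmul : ∀ q : T, Continuous fun x : T => x * q) (hεmul : ∀ s : S, Continuous fun x : T => ε s * x)
    {p : T} (h : ∀ A ∈ comap ε (𝓝 p), IsSyndetic {s : S | (fun t => s * t) ⁻¹' A ∈ comap ε (𝓝 p)})
    (q : T) : ∃ x : T, p = x * q * p := by
  have hne : (comap ε (𝓝 p)).NeBot := comap_neBot_iff.2 fun N hN => hε.mem_nhds hN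
  let D : (comap ε (𝓝 p)).sets → Set T := fun A => {x | x * q * p ∈ closure (ε '' A)}
  have hcont : Continuous fun x : T => x * q * p := (hmul p).comp (hmul q)
  have hDclosed : ∀ A, IsClosed (D A) := fun A => isClosed_closure.preimage hcont
  have hDmono : ∀ A B : (comap ε (𝓝 p)).sets, (A : Set S) ⊆ B → D A ⊆ D B :=
    fun A B hAB x hx => closure_mono (image_mono hAB) hx
  have hDne : ∀ A, (D A).Nonempty := by
    rintro ⟨A, hA⟩
    obtain ⟨E, hE⟩ := h A hA
    have hcover : ∀ t : S, ∃ s ∈ E, ε s * (ε t * p) ∈ closure (ε '' A) := fun t => by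
      have ht : t ∈ ⋃ s ∈ E, (fun t => s * t) ⁻¹'
          {s : S | (fun t => s * t) ⁻¹' A ∈ comap ε (𝓝 p)} := hE ▸ mem_univ t
      simp only [mem_iUnion, exists_prop] at ht
      obtain ⟨s, hs, hst⟩ := ht
      refine ⟨s, hs, ?_⟩
      suffices ε (s * t) * p ∈ closure (ε '' A) by rwa [map_mul, mul_assoc] at this
      refine mem_closure_of_tendsto (b := comap ε (𝓝 p)) (((hεmul (s * t)).tendsto p).comp tendsto_comap) ?_
      filter_upwards [show (fun u => s * t * u) ⁻¹' A ∈ comap ε (𝓝 p) from hst] with u hu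
      exact ⟨s * t * u, hu, map_mul ε _ _⟩
    -- Finiteness of `E` keeps the union closed, so the covering property passes from the dense set
    -- `ε(S)` to `q`.
    have hclosed : IsClosed (⋃ s ∈ E, {y : T | ε s * (y * p) ∈ closure (ε '' A)}) :=
      E.finite_toSet.isClosed_biUnion fun s _ =>
        isClosed_closure.preimage ((hεmul s).comp (hmul p))
    have hq : q ∈ ⋃ s ∈ E, {y : T | ε s * (y * p) ∈ closure (ε '' A)} := by
      refine hε.induction_on (p := fun q => q ∈ ⋃ s ∈ E, {y : T | ε s * (y * p) ∈ closure (ε '' A)})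
        q hclosed fun t => ?_
      obtain ⟨s, hs, hst⟩ := hcover t
      exact mem_biUnion hs hst
    simp only [mem_iUnion, exists_prop] at hq
    obtain ⟨s, -, hs⟩ := hq
    exact ⟨ε s, by simpa only [D, mem_ofPred_eq, mul_assoc] using hs⟩
  have : Nonempty (comap ε (𝓝 p)).sets := ⟨⟨univ, univ_mem⟩⟩
  obtain ⟨x, hx⟩ := IsCompact.nonempty_iInter_of_directed_nonempty_isCompact_isClosed D
    (fun A B => ⟨⟨A ∩ B, inter_mem A.2 B.2⟩, hDmono _ _ inter_subset_left,
      hDmono _ _ inter_subset_right⟩) hDne (fun A => (hDclosed A).isCompact) hDclosed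
  refine ⟨x, ?_⟩
  by_contra hpx
  obtain ⟨U, V, hU, hV, hpU, hxV, hUV⟩ := t2_separation hpx
  -- The trace of `U` is one of the sets `A`, so `xqp` would adhere to `U`, although `V` separates
  -- it from `U`.
  have hxD := mem_iInter.1 hx ⟨ε ⁻¹' U, preimage_mem_comap (hU.mem_nhds hpU)⟩
  obtain ⟨y, hyV, s, hs, rfl⟩ := mem_closure_iff.1 hxD V hV hxV
  exact disjoint_left.1 hUV hs hyV

/-- Given an open `U` around `p = xqp`, density allows `x` to be replaced by some `ε(s)` with
`ε(s)qp ∈ U`. This is an open condition on `q`, so finitely many `s` suffice for all `q`, in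
particular for `q = ε(t)`. -/
lemma isSyndetic_of_forall_exists_eq_mul (hε : DenseRange ε)
    (hmul : ∀ q : T, Continuous fun x : T => x * q) (hεmul : ∀ s : S, Continuous fun x : T => ε s * x)
    {p : T} (h : ∀ q : T, ∃ x : T, p = x * q * p) {A : Set S} (hA : A ∈ comap ε (𝓝 p)) :
    IsSyndetic {s : S | (fun t => s * t) ⁻¹' A ∈ comap ε (𝓝 p)} := by
  obtain ⟨N, hN, hNA⟩ := hA
  obtain ⟨U, hUN, hU, hpU⟩ := mem_nhds_iff.1 hN
  let W : S → Set T := fun s => {q | ε s * (q * p) ∈ U}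
  have hW : ∀ s, IsOpen (W s) := fun s => hU.preimage ((hεmul s).comp (hmul p))
  have hcover : univ ⊆ ⋃ s, W s := fun q _ => by
    obtain ⟨x, hx⟩ := h q
    obtain ⟨s, hs⟩ := hε.exists_mem_open (hU.preimage (hmul (q * p)))
      ⟨x, by rw [mem_preimage, ← mul_assoc, ← hx]; exact hpU⟩
    exact mem_iUnion.2 ⟨s, hs⟩
  obtain ⟨E, hE⟩ := isCompact_univ.elim_finite_subcover W hW hcover
  refine ⟨E, eq_univ_of_forall fun t => ?_⟩
  obtain ⟨s, hs, hst⟩ := mem_iUnion₂.1 (hE (mem_univ (ε t)))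
  refine mem_biUnion hs ?_
  have hst' : ε (s * t) * p ∈ U := by rw [map_mul, mul_assoc]; exact hst
  filter_upwards [tendsto_comap.eventually
    ((hεmul (s * t)).continuousAt.eventually_mem (hU.mem_nhds hst'))] with u hu
  exact hNA (hUN (by rw [map_mul]; exact hu))

end CompactRightTopological

/-! ### Filters of characters as traces of weak* neighbourhoods -/

section KerFilter

variable {S : Type*} [TopologicalSpace S] {𝓐 : StarSubalgebra ℂ (S →ᵇ ℂ)}

lemma tendsto_kerFilter (μ : WeakDual.characterSpace ℂ 𝓐) (f : 𝓐) :
    Tendsto (f : S →ᵇ ℂ) (kerFilter 𝓐 μ) (𝓝 (μ f)) := by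
  rw [Metric.tendsto_nhds]
  intro r hr
  refine (mem_kerFilter_iff μ _).2 ⟨_, sub_const_mem_ker μ f, r / 2, by positivity, fun s hs => ?_⟩
  have hs' : ‖(f : S →ᵇ ℂ) s - μ f‖ ≤ r / 2 := hs
  change dist _ _ < r
  rw [dist_eq_norm]
  linarith

/-- Evaluation at a point, as a character of `𝓐`. -/
noncomputable def evalCharacter (h𝓐 : IsClosed (𝓐 : Set (S →ᵇ ℂ))) (s : S) :
    WeakDual.characterSpace ℂ 𝓐 :=
  haveI := h𝓐
  WeakDual.CharacterSpace.equivAlgHom.symm (evalStarHom 𝓐 s).toAlgHom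

@[simp] lemma evalCharacter_apply (h𝓐 : IsClosed (𝓐 : Set (S →ᵇ ℂ))) (s : S) (f : 𝓐) :
    evalCharacter h𝓐 s f = (f : S →ᵇ ℂ) s := rfl

lemma continuous_characterSpace_iff {X : Type*} [TopologicalSpace X]
    {g : X → WeakDual.characterSpace ℂ 𝓐} :
    Continuous g ↔ ∀ f : 𝓐, Continuous fun x => g x f := by
  rw [continuous_induced_rng]
  exact ⟨fun h f => (WeakDual.eval_continuous f).comp h, fun h => WeakDual.continuous_of_continuous_eval h⟩

/-- Along `kerFilter 𝓐 μ` every `f` tends to `μ f`, which is weak* convergence of the evaluations to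
`μ`. Conversely, a generating sublevel set contains the trace of the neighbourhood `{ν | ‖ν f‖ <
r}`. -/
lemma kerFilter_eq_comap (h𝓐 : IsClosed (𝓐 : Set (S →ᵇ ℂ))) (μ : WeakDual.characterSpace ℂ 𝓐) :
    kerFilter 𝓐 μ = comap (evalCharacter h𝓐) (𝓝 μ) := by
  refine le_antisymm ?_ fun A hA => ?_
  · rw [← tendsto_iff_comap, tendsto_subtype_rng]
    exact (WeakBilin.tendsto_iff_forall_eval_tendsto _ ContinuousLinearMap.coe_injective).2
      (tendsto_kerFilter μ)
  · obtain ⟨f, hf, r, hr, h⟩ := (mem_kerFilter_iff μ A).1 hA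
    have hc : Continuous fun ν : WeakDual.characterSpace ℂ 𝓐 => ‖ν f‖ :=
      (continuous_characterSpace_iff.1 continuous_id f).norm
    have hlt : ∀ᶠ ν in 𝓝 μ, ‖ν f‖ < r := hc.continuousAt.eventually_lt_const (by simpa [hf])
    exact ⟨_, hlt, fun s hs => h (le_of_lt (b := r) hs)⟩

end KerFilter

/-! ### Topology of the spectrum and of `δS` -/

namespace MAdmissibleSubalgebra

variable {S : Type*} [Semigroup S] [TopologicalSpace S] [SeparatelyContinuousMul S]
  (F : MAdmissibleSubalgebra S)

lemma continuous_spectrumMul_const (ν : F.Spectrum) :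
    Continuous fun μ : F.Spectrum => F.spectrumMul μ ν :=
  continuous_characterSpace_iff.2 fun f => continuous_characterSpace_iff.1 continuous_id (F.T ν f)

lemma evalCharacter_spectrumMul_apply (s : S) (μ : F.Spectrum) (f : F.alg) :
    F.spectrumMul (evalCharacter F.isClosed_alg s) μ f = μ (F.L s f) := by
  rw [spectrumMul_apply, evalCharacter_apply, T_apply]

/-- For an evaluation as left factor, the product at `f` is the value of `μ` at the fixed element
`F.L s f`; for a general left factor it involves `F.T μ f`, which varies with `μ`. -/
lemma continuous_evalCharacter_spectrumMul (s : S) :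
    Continuous fun μ : F.Spectrum => F.spectrumMul (evalCharacter F.isClosed_alg s) μ :=
  continuous_characterSpace_iff.2 fun f => by
    simp only [evalCharacter_spectrumMul_apply]
    exact continuous_characterSpace_iff.1 continuous_id (F.L s f)

lemma evalCharacter_mul (s t : S) :
    evalCharacter F.isClosed_alg (s * t) =
      F.spectrumMul (evalCharacter F.isClosed_alg s) (evalCharacter F.isClosed_alg t) := by
  ext f
  rw [evalCharacter_spectrumMul_apply]
  rfl

variable [Nonempty S]

/-- The topology of `δS`, transported from the spectrum. -/
noncomputable instance : TopologicalSpace F.DeltaS :=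
  TopologicalSpace.induced F.spectrumEquiv.symm inferInstance

/-- The canonical homeomorphism `Δ ≃ₜ δS`. -/
noncomputable def spectrumHomeomorph : F.Spectrum ≃ₜ F.DeltaS :=
  (F.spectrumEquiv.symm.toHomeomorphOfIsInducing ⟨rfl⟩).symm

lemma spectrumHomeomorph_mul (μ ν : F.Spectrum) :
    F.spectrumHomeomorph (F.spectrumMul μ ν) =
      F.spectrumHomeomorph μ * F.spectrumHomeomorph ν := by
  change F.spectrumEquiv _ = F.spectrumEquiv (F.spectrumMul (F.spectrumEquiv.symm
    (F.spectrumEquiv μ)) (F.spectrumEquiv.symm (F.spectrumEquiv ν)))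
  rw [Equiv.symm_apply_apply, Equiv.symm_apply_apply]

instance : CompactSpace F.DeltaS :=
  haveI : IsClosed (F.alg : Set (S →ᵇ ℂ)) := F.isClosed_alg
  F.spectrumHomeomorph.compactSpace

instance : T2Space F.DeltaS := F.spectrumHomeomorph.t2Space

/-- The canonical homomorphism `S → δS`. -/
noncomputable def toDeltaS : S →ₙ* F.DeltaS where
  toFun s := F.spectrumHomeomorph (evalCharacter F.isClosed_alg s)
  map_mul' s t := by rw [evalCharacter_mul, spectrumHomeomorph_mul]

lemma filter_eq_comap_toDeltaS (p : F.DeltaS) : p.filter = comap F.toDeltaS (𝓝 p) := by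
  obtain ⟨μ, rfl⟩ := F.spectrumHomeomorph.surjective p
  have h : comap F.toDeltaS (𝓝 (F.spectrumHomeomorph μ)) =
      comap (evalCharacter F.isClosed_alg) (𝓝 μ) := by
    rw [F.spectrumHomeomorph.isInducing.nhds_eq_comap μ, comap_comap]
    rfl
  rw [h, ← kerFilter_eq_comap]
  rfl

/-- Properness of the filter `p` says that every neighbourhood of `p` meets the image of `S`. -/
lemma denseRange_toDeltaS : DenseRange F.toDeltaS := fun p => by
  have : (comap F.toDeltaS (𝓝 p)).NeBot := F.filter_eq_comap_toDeltaS p ▸ p.2.1.1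
  exact mem_closure_of_tendsto tendsto_comap (Eventually.of_forall mem_range_self)

lemma continuous_mul_const_deltaS (q : F.DeltaS) : Continuous fun x : F.DeltaS => x * q := by
  obtain ⟨ν, rfl⟩ := F.spectrumHomeomorph.surjective q
  rw [← F.spectrumHomeomorph.comp_continuous_iff']
  simpa only [Function.comp_def, spectrumHomeomorph_mul] using
    F.spectrumHomeomorph.continuous.comp (F.continuous_spectrumMul_const ν)

lemma continuous_toDeltaS_mul (s : S) : Continuous fun x : F.DeltaS => F.toDeltaS s * x := by
  rw [← F.spectrumHomeomorph.comp_continuous_iff']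
  refine (F.spectrumHomeomorph.continuous.comp
    (F.continuous_evalCharacter_spectrumMul s)).congr fun μ => ?_
  exact F.spectrumHomeomorph_mul _ μ

lemma omega_eq (p : F.DeltaS) (A : Set S) :
    F.Omega p A = {s | (fun t => s * t) ⁻¹' A ∈ comap F.toDeltaS (𝓝 p)} := by
  rw [← filter_eq_comap_toDeltaS]
  rfl

end MAdmissibleSubalgebra

theorem mainTheorem1 {S : Type*} [Nonempty S] [Semigroup S] [TopologicalSpace S] [T2Space S]
    [SeparatelyContinuousMul S] (F : MAdmissibleSubalgebra S) :
    IsLeast {I : Set F.DeltaS | IsSemigroupIdeal I} (smallestIdeal F.DeltaS) ∧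
    ∀ p : F.DeltaS,
      [p ∈ smallestIdeal F.DeltaS,
        ∀ A ∈ p.filter, IsSyndetic (F.Omega p A),
        ∀ q : F.DeltaS, ∃ x : F.DeltaS, p = x * q * p].TFAE := by
  have : Nonempty F.DeltaS := Nonempty.map F.toDeltaS inferInstance
  have hex := exists_forall_exists_eq_mul F.continuous_mul_const_deltaS
  have hK := smallestIdeal_eq_setOf_forall_exists_eq_mul hex
  refine ⟨⟨?_, fun I hI => sInter_subset_of_mem hI⟩, fun p => ?_⟩
  · rw [hK]
    exact isSemigroupIdeal_setOf_forall_exists_eq_mul hex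
  · tfae_have 1 ↔ 3 := by rw [hK]; rfl
    tfae_have 3 → 2 := fun h A hA => by
      rw [F.omega_eq]
      exact isSyndetic_of_forall_exists_eq_mul F.denseRange_toDeltaS F.continuous_mul_const_deltaS
        F.continuous_toDeltaS_mul h (F.filter_eq_comap_toDeltaS p ▸ hA)
    tfae_have 2 → 3 := fun h => by
      simp only [F.omega_eq, F.filter_eq_comap_toDeltaS] at h
      exact exists_eq_mul_of_isSyndetic F.denseRange_toDeltaS F.continuous_mul_const_deltaS
        F.continuous_toDeltaS_mul h
    tfae_finish
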